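/- Let $G$ be a virtually abelian group (that is, $G$ has an abelian subgroup of finite index), let $S\subseteq G$ be a finite set that generates $G$ as a monoid, and let $\omega\colon S\to\{1,2,3,\ldots\}$ be any weight function. The weight of a word $s_1s_2\cdots s_k$ over $S$ is $\omega(s_1)+\cdots+\omega(s_k)$ (the empty word has weight $0$), and the weight $\omega(g)$ of an element $g\in G$ is the minimal weight of a word over $S$ that represents $g$. Let $H_1,\ldots,H_k$ be finitely many subgroups of $G$ and let $U=H_1\cup\cdots\cup H_k$. Then the weighted growth series of $U$ relative to $G$, \[\sum_{n=0}^{\infty}\#\{g\in U\mid \omega(g)=n\}\,z^n,\] is a rational function, i.e. it equals $p(z)/q(z)$ as a formal power series for some polynomials $p,q$ with integer coefficients, $q\neq 0$. -/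

import Mathlib

namespace WeightedGrowth

/-- A group is virtually abelian if it has an abelian subgroup of finite index. -/
def IsVirtuallyAbelian (G : Type*) [Group G] : Prop :=
  ∃ A : Subgroup G, IsMulCommutative A ∧ A.FiniteIndex

section

variable {G : Type*} [Group G] {S : Finset G}

/-- The element of `G` represented by a word over `S`. -/
def wordValue (w : List S) : G := (w.map Subtype.val).prod

/-- The weight of a word: the sum of the weights of its letters (so the empty word has weight 0). -/
def wordWeight (ω : S → ℕ) (w : List S) : ℕ := (w.map ω).sum

/-- The weight of a group element: the minimal weight of a word over `S` representing it
(used only when every element is represented by some word). -/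
noncomputable def weight (ω : S → ℕ) (g : G) : ℕ :=
  sInf {n : ℕ | ∃ w : List S, wordValue w = g ∧ wordWeight ω w = n}

/-- The relative weighted growth function of `U`: the number of elements of `U` of weight
exactly `n` with respect to the weighted generating set of `G`. -/
noncomputable def relGrowth (ω : S → ℕ) (U : Set G) (n : ℕ) : ℕ :=
  Set.ncard {g : G | g ∈ U ∧ weight ω g = n}

/-- The relative weighted growth series `∑ n, relGrowth ω U n * z ^ n`. -/
noncomputable def relGrowthSeries (ω : S → ℕ) (U : Set G) : PowerSeries ℤ :=
  PowerSeries.mk fun n => (relGrowth ω U n : ℤ)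

/-- If `S` generates `G` as a monoid, the minimal weight of an element is attained by a word. -/
theorem exists_word_weight (hS : Submonoid.closure (S : Set G) = ⊤) (ω : S → ℕ) (g : G) :
    ∃ w : List S, wordValue w = g ∧ wordWeight ω w = weight ω g := by
  have hg : g ∈ Submonoid.closure (S : Set G) := hS ▸ Submonoid.mem_top g
  obtain ⟨l, hl, rfl⟩ := Submonoid.exists_list_of_mem_closure hg
  have hw : wordValue (S := S) (l.attach.map fun x => ⟨x.1, hl x.1 x.2⟩) = l.prod := by
    simp [wordValue, List.map_map, Function.comp_def]
  exact Nat.sInf_mem (s := {n : ℕ | ∃ w : List S, wordValue w = l.prod ∧ wordWeight ω w = n})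
    ⟨_, _, hw, rfl⟩

/-- The sets counted by `relGrowth` are finite, so the cardinality there is the true one. -/
theorem finite_weight_eq (hS : Submonoid.closure (S : Set G) = ⊤) (ω : S → ℕ)
    (hω : ∀ s, 0 < ω s) (U : Set G) (n : ℕ) : {g : G | g ∈ U ∧ weight ω g = n}.Finite := by
  refine ((List.finite_length_le S n).image wordValue).subset ?_
  rintro g ⟨-, hg⟩
  obtain ⟨w, hw, hwt⟩ := exists_word_weight hS ω g
  refine ⟨w, ?_, hw⟩
  have key : ∀ v : List S, v.length ≤ wordWeight ω v := by
    intro v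
    induction v with
    | nil => simp [wordWeight]
    | cons a t ih =>
      have := hω a
      simp only [wordWeight, List.map_cons, List.sum_cons, List.length_cons] at ih ⊢
      omega
  exact (key w).trans (hwt.trans hg).le

end

/-- A power series `f` with integer coefficients is rational if `f = p / q` for polynomials
`p`, `q` with integer coefficients, `q ≠ 0`. -/
def IsRationalSeries (f : PowerSeries ℤ) : Prop :=
  ∃ p q : Polynomial ℤ, q ≠ 0 ∧ (q : PowerSeries ℤ) * f = (p : PowerSeries ℤ)

end WeightedGrowth

open AddSubmonoid Pointwise
open scoped IsMulCommutative

namespace WeightedGrowth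

/-! Let `A` be abelian of finite index. A word over `S` traces a path in the finite graph on `G ⧸
A`, and its element and weight are the sum of the edge labels in the commutative monoid `Additive A
× ℕ` (`wordLabels_eq`). Kleene's recursion makes the set of path labels semilinear
(`isSemilinearSet_pathLabel`). Removing its strict upward shift in the weight coordinate leaves the
graph of the weight function (`isSemilinearSet_weightGraph`). Each subgroup is a coset of a finitely
generated group in these coordinates, so the part of `U` in each coset of `A` becomes a semilinear
set.

It remains to count a semilinear set by an additive function with finite fibres
(`IsSemilinearSet.isRationalSeries_countSeries`). Inclusion-exclusion reduces unions to finitely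
many translates of one finitely generated monoid. Such a set is counted by adding one translate at a
time and removing what is already covered (`isRationalSeries_countSeries_coset_diff`); Dickson's
lemma makes the uncovered part eventually periodic. -/

theorem IsRationalSeries.coe (p : Polynomial ℤ) : IsRationalSeries (p : PowerSeries ℤ) :=
  ⟨p, 1, one_ne_zero, by simp⟩

theorem IsRationalSeries.zero : IsRationalSeries 0 := by
  simpa using IsRationalSeries.coe 0

theorem IsRationalSeries.add {f g : PowerSeries ℤ} (hf : IsRationalSeries f)
    (hg : IsRationalSeries g) : IsRationalSeries (f + g) := by
  obtain ⟨p, q, hq, h⟩ := hf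
  obtain ⟨p', q', hq', h'⟩ := hg
  refine ⟨p * q' + p' * q, q * q', mul_ne_zero hq hq', ?_⟩
  push_cast
  rw [← h, ← h']
  ring

theorem IsRationalSeries.neg {f : PowerSeries ℤ} (hf : IsRationalSeries f) :
    IsRationalSeries (-f) := by
  obtain ⟨p, q, hq, h⟩ := hf
  refine ⟨-p, q, hq, ?_⟩
  rw [mul_neg, h]
  exact ((Polynomial.coeToPowerSeries.ringHom (R := ℤ)).map_neg p).symm

theorem IsRationalSeries.sub {f g : PowerSeries ℤ} (hf : IsRationalSeries f)
    (hg : IsRationalSeries g) : IsRationalSeries (f - g) := by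
  rw [sub_eq_add_neg]
  exact hf.add hg.neg

theorem IsRationalSeries.of_mul {f : PowerSeries ℤ} {r : Polynomial ℤ} (hr : r ≠ 0)
    (h : IsRationalSeries ((r : PowerSeries ℤ) * f)) : IsRationalSeries f := by
  obtain ⟨p, q, hq, h⟩ := h
  refine ⟨p, q * r, mul_ne_zero hq hr, ?_⟩
  rw [← h]
  push_cast
  ring

theorem IsRationalSeries.sum {κ : Type*} (t : Finset κ) {f : κ → PowerSeries ℤ}
    (hf : ∀ i ∈ t, IsRationalSeries (f i)) : IsRationalSeries (∑ i ∈ t, f i) := by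
  classical
  induction t using Finset.induction_on with
  | empty => simpa using IsRationalSeries.zero
  | insert a t ha ih =>
    rw [Finset.sum_insert ha]
    exact (hf a (Finset.mem_insert_self a t)).add
      (ih fun i hi => hf i (Finset.mem_insert_of_mem hi))

/-- If `f = g + z ^ w * f` with `g` rational and `w > 0`, then `f` is rational. -/
theorem IsRationalSeries.of_eq_add_X_pow_mul {f g : PowerSeries ℤ} {w : ℕ} (hw : 0 < w)
    (hg : IsRationalSeries g) (h : f = g + PowerSeries.X ^ w * f) : IsRationalSeries f := by
  have hr : (1 - Polynomial.X ^ w : Polynomial ℤ) ≠ 0 := by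
    intro h0
    have := congrArg (fun p => Polynomial.eval 0 p) h0
    simp [hw.ne'] at this
  refine IsRationalSeries.of_mul hr ?_
  have : (((1 - Polynomial.X ^ w : Polynomial ℤ)) : PowerSeries ℤ) * f = g := by
    have hc : ((1 - Polynomial.X ^ w : Polynomial ℤ) : PowerSeries ℤ)
        = 1 - PowerSeries.X ^ w := by
      simp
    rw [hc, sub_mul, one_mul, sub_eq_iff_eq_add]
    exact h
  rwa [this]

/-! ### Counting series of sets with finite fibres -/

section Counting

variable {B : Type*}

/-- All fibres of `ℓ` on `X` are finite. -/
def FiniteFibers (ℓ : B → ℕ) (X : Set B) : Prop := ∀ n, {x | x ∈ X ∧ ℓ x = n}.Finite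

/-- The generating series counting the elements of `X` according to their value under `ℓ`. -/
noncomputable def countSeries (ℓ : B → ℕ) (X : Set B) : PowerSeries ℤ :=
  PowerSeries.mk fun n => ({x | x ∈ X ∧ ℓ x = n}.ncard : ℤ)

variable {ℓ : B → ℕ} {X Y : Set B}

theorem FiniteFibers.mono (hY : FiniteFibers ℓ Y) (h : X ⊆ Y) : FiniteFibers ℓ X :=
  fun n => (hY n).subset fun _ hx => ⟨h hx.1, hx.2⟩

theorem countSeries_union_add_inter (hX : FiniteFibers ℓ X) (hY : FiniteFibers ℓ Y) :
    countSeries ℓ (X ∪ Y) + countSeries ℓ (X ∩ Y) = countSeries ℓ X + countSeries ℓ Y := by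
  ext n
  have h := Set.ncard_union_add_ncard_inter _ _ (hX n) (hY n)
  have e₁ : {x | x ∈ X ∪ Y ∧ ℓ x = n} = {x | x ∈ X ∧ ℓ x = n} ∪ {x | x ∈ Y ∧ ℓ x = n} := by
    ext x; simp only [Set.mem_union, Set.mem_ofPred_eq]; tauto
  have e₂ : {x | x ∈ X ∩ Y ∧ ℓ x = n} = {x | x ∈ X ∧ ℓ x = n} ∩ {x | x ∈ Y ∧ ℓ x = n} := by
    ext x; simp only [Set.mem_inter_iff, Set.mem_ofPred_eq]; tauto
  simp only [countSeries, map_add, PowerSeries.coeff_mk, e₁, e₂]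
  exact_mod_cast h

@[simp]
theorem countSeries_empty : countSeries ℓ ∅ = 0 := by
  ext n
  simp [countSeries]

theorem countSeries_union (hX : FiniteFibers ℓ X) (hY : FiniteFibers ℓ Y) (h : Disjoint X Y) :
    countSeries ℓ (X ∪ Y) = countSeries ℓ X + countSeries ℓ Y := by
  rw [← countSeries_union_add_inter hX hY, h.inter_eq, countSeries_empty, add_zero]

theorem countSeries_singleton (x : B) : countSeries ℓ {x} = PowerSeries.X ^ ℓ x := by
  ext n
  rw [countSeries, PowerSeries.coeff_mk, PowerSeries.coeff_X_pow]
  split_ifs with h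
  · have : {y | y ∈ ({x} : Set B) ∧ ℓ y = n} = {x} := by
      ext y; simp only [Set.mem_singleton_iff, Set.mem_ofPred_eq]
      exact ⟨And.left, fun hy => ⟨hy, hy ▸ h.symm⟩⟩
    rw [this]
    simp
  · have : {y | y ∈ ({x} : Set B) ∧ ℓ y = n} = ∅ := by
      ext y; simp only [Set.mem_singleton_iff, Set.mem_ofPred_eq, Set.mem_empty_iff_false, iff_false]
      rintro ⟨rfl, hy⟩
      exact h hy.symm
    rw [this]
    simp

theorem eq_empty_of_countSeries_eq_zero (hX : FiniteFibers ℓ X) (h : countSeries ℓ X = 0) :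
    X = ∅ := by
  refine Set.eq_empty_of_forall_notMem fun x hx => ?_
  have h0 := congrArg (PowerSeries.coeff (ℓ x)) h
  simp only [countSeries, PowerSeries.coeff_mk, map_zero, Nat.cast_eq_zero] at h0
  -- Finite fibres exclude the default value `0` of `ncard` on infinite sets.
  rw [Set.ncard_eq_zero (hX _)] at h0
  exact (h0 ▸ (⟨hx, rfl⟩ : x ∈ {y | y ∈ X ∧ ℓ y = ℓ x}) : x ∈ (∅ : Set B))

end Counting

theorem countSeries_image_add_right {B : Type*} [AddCancelCommMonoid B] (ℓ : B →+ ℕ) (X : Set B)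
    (p : B) : countSeries ℓ ((· + p) '' X) = PowerSeries.X ^ ℓ p * countSeries ℓ X := by
  ext n
  rw [PowerSeries.coeff_X_pow_mul', countSeries, countSeries, PowerSeries.coeff_mk]
  split_ifs with h
  · have : {x | x ∈ (· + p) '' X ∧ ℓ x = n} = (· + p) '' {x | x ∈ X ∧ ℓ x = n - ℓ p} := by
      ext y
      simp only [Set.mem_image, Set.mem_ofPred_eq]
      constructor
      · rintro ⟨⟨x, hx, rfl⟩, hy⟩
        rw [map_add] at hy
        exact ⟨x, ⟨hx, by omega⟩, rfl⟩
      · rintro ⟨x, ⟨hx, hxn⟩, rfl⟩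
        refine ⟨⟨x, hx, rfl⟩, ?_⟩
        rw [map_add]
        omega
    rw [this, PowerSeries.coeff_mk, Set.ncard_image_of_injective _ (add_left_injective p)]
  · have : {x | x ∈ (· + p) '' X ∧ ℓ x = n} = ∅ := by
      refine Set.eq_empty_of_forall_notMem ?_
      rintro _ ⟨⟨x, -, rfl⟩, hx⟩
      rw [map_add] at hx
      omega
    rw [this]
    simp

/-! ### Cosets of a finitely generated monoid minus a stable set -/

/-- Ascending chain condition for subsets of a finitely generated commutative monoid that are
stable under translation. -/
theorem exists_forall_ge_eq_of_monotone {B : Type*} [AddCommMonoid B] (s : Finset B)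
    {Z : ℕ → Set B} (hZ : Monotone Z) (hsub : ∀ j, Z j ⊆ closure (s : Set B))
    (hadd : ∀ j, ∀ x ∈ Z j, ∀ m ∈ closure (s : Set B), x + m ∈ Z j) :
    ∃ J, ∀ j, J ≤ j → Z j = Z J := by
  by_contra! hcon
  have hx : ∀ J, ∃ j, J ≤ j ∧ ∃ x, x ∈ Z j ∧ x ∉ Z J := by
    intro J
    obtain ⟨j, hj, hne⟩ := hcon J
    exact ⟨j, hj, Set.not_subset.1 fun h => hne (h.antisymm (hZ hj))⟩
  choose next hnext x hx hx' using hx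
  let idx : ℕ → ℕ := fun k => next^[k] 0
  have hidx : ∀ k, idx (k + 1) = next (idx k) := fun k => Function.iterate_succ_apply' _ _ _
  have hmono : Monotone idx := monotone_nat_of_le_succ fun k => by
    rw [hidx]; exact hnext _
  have hrep : ∀ k, ∃ a : s → ℕ, x (idx k) = ∑ i : s, a i • i.1 :=
    fun k => mem_closure_finset'.1 (hsub _ (hx (idx k)))
  choose a ha using hrep
  -- Dickson's lemma: a later new element is an earlier one plus an element of the monoid, so by
  -- stability it was not new.
  obtain ⟨k, l, hkl, hle⟩ := wellQuasiOrdered_le a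
  apply hx' (idx l)
  have h₁ : x (idx k) ∈ Z (idx l) :=
    hZ (hmono (Nat.succ_le_of_lt hkl)) (by rw [Nat.succ_eq_add_one, hidx]; exact hx _)
  have h₂ : x (idx l) = x (idx k) + ∑ i : s, (a l i - a k i) • i.1 := by
    rw [ha, ha, ← Finset.sum_add_distrib]
    refine Finset.sum_congr rfl fun i _ => ?_
    rw [← add_smul, Nat.add_sub_cancel' (hle i)]
  rw [h₂]
  exact hadd _ _ h₁ _ (sum_mem fun i _ => nsmul_mem (subset_closure i.2) _)

/-- A coset `f + M` of a finitely generated commutative monoid, with an `M`-stable subset removed,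
has a rational counting series. -/
theorem isRationalSeries_countSeries_coset_diff {B : Type*} [AddCancelCommMonoid B] (ℓ : B →+ ℕ)
    (s : Finset B) : ∀ (f : B) (Y : Set B),
      (∀ y ∈ Y, ∀ m ∈ closure (s : Set B), y + m ∈ Y) →
      FiniteFibers ℓ ((f +ᵥ (closure (s : Set B) : Set B)) \ Y) →
      IsRationalSeries (countSeries ℓ ((f +ᵥ (closure (s : Set B) : Set B)) \ Y)) := by
  classical
  induction s using Finset.induction_on with
  | empty =>
    intro f Y _ _
    simp only [Finset.coe_empty, AddSubmonoid.closure_empty, coe_bot, Set.vadd_set_singleton, vadd_eq_add,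
      add_zero]
    by_cases hf : f ∈ Y
    · rw [Set.sdiff_eq_empty.2 (Set.singleton_subset_iff.2 hf), countSeries_empty]
      exact .zero
    · rw [sdiff_eq_left.2 (Set.disjoint_singleton_left.2 hf), countSeries_singleton]
      simpa using IsRationalSeries.coe (Polynomial.X ^ ℓ f)
  | insert p s _ ih =>
    intro f Y hY hfin
    set M := closure (s : Set B)
    have hMle : M ≤ closure ((insert p s : Finset B) : Set B) :=
      closure_mono (by simp)
    have hp : p ∈ closure ((insert p s : Finset B) : Set B) := subset_closure (by simp)
    have hX : ∀ x, x ∈ f +ᵥ (closure ((insert p s : Finset B) : Set B) : Set B) ↔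
        ∃ i : ℕ, ∃ m ∈ M, x = f + (i • p + m) := by
      intro x
      simp only [Set.mem_vadd_set, SetLike.mem_coe, vadd_eq_add, Finset.coe_insert,
        Set.insert_eq, AddSubmonoid.closure_union, mem_sup, mem_closure_singleton]
      constructor
      · rintro ⟨_, ⟨_, ⟨i, rfl⟩, m, hm, rfl⟩, rfl⟩
        exact ⟨i, m, hm, rfl⟩
      · rintro ⟨i, m, hm, rfl⟩
        exact ⟨_, ⟨_, ⟨i, rfl⟩, m, hm, rfl⟩, rfl⟩
    set X := f +ᵥ (closure ((insert p s : Finset B) : Set B) : Set B)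
    -- Slice the coset into layers `f + i • p + M`. `W j` is `Y` with the layers below `j`, `T j` is
    -- what remains outside it, and `D j` is the new part of layer `j`, to which the induction
    -- hypothesis applies.
    let W : ℕ → Set B := fun j => Y ∪ {x | ∃ i < j, ∃ m ∈ M, x = f + (i • p + m)}
    let T : ℕ → Set B := fun j => X \ W j
    let D : ℕ → Set B := fun j => ((f + j • p) +ᵥ (M : Set B)) \ W j
    have hWM : ∀ j, ∀ y ∈ W j, ∀ m ∈ M, y + m ∈ W j := by
      rintro j y (hy | ⟨i, hi, m', hm', rfl⟩) m hm
      · exact .inl (hY y hy m (hMle hm))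
      · exact .inr ⟨i, hi, m' + m, add_mem hm' hm, by simp only [add_assoc]⟩
    have hWmono : Monotone W := by
      rintro j k hjk y (hy | ⟨i, hi, h⟩)
      · exact .inl hy
      · exact .inr ⟨i, hi.trans_le hjk, h⟩
    have hT0 : T 0 = X \ Y := by simp [T, W]
    have hTfin : ∀ j, FiniteFibers ℓ (T j) := fun j =>
      hfin.mono (Set.sdiff_subset_sdiff_right Set.subset_union_left)
    have hDT : ∀ j, D j ⊆ T j := by
      rintro j x ⟨hx, hxW⟩
      obtain ⟨m, hm, rfl⟩ := Set.mem_vadd_set.1 hx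
      exact ⟨(hX _).2 ⟨j, m, hm, by simp [add_assoc]⟩, hxW⟩
    have hTD : ∀ j, T j = D j ∪ T (j + 1) := by
      intro j
      refine Set.Subset.antisymm ?_ (Set.union_subset (hDT j)
        (Set.sdiff_subset_sdiff_right (hWmono j.le_succ)))
      rintro x ⟨hx, hxW⟩
      by_cases hxj : x ∈ (f + j • p) +ᵥ (M : Set B)
      · exact .inl ⟨hxj, hxW⟩
      · refine .inr ⟨hx, ?_⟩
        rintro (hy | ⟨i, hi, m, hm, rfl⟩)
        · exact hxW (.inl hy)
        · rcases Nat.lt_succ_iff_lt_or_eq.1 hi with hi | rfl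
          · exact hxW (.inr ⟨i, hi, m, hm, rfl⟩)
          · exact hxj (Set.mem_vadd_set.2 ⟨m, hm, by simp [add_assoc]⟩)
    have hdisj : ∀ j, Disjoint (D j) (T (j + 1)) := by
      intro j
      refine Set.disjoint_left.2 ?_
      rintro x ⟨hx, -⟩ ⟨-, hxW⟩
      obtain ⟨m, hm, rfl⟩ := Set.mem_vadd_set.1 hx
      exact hxW (.inr ⟨j, j.lt_succ_self, m, hm, by simp [add_assoc]⟩)
    have hDrat : ∀ j, IsRationalSeries (countSeries ℓ (D j)) := fun j =>
      ih _ _ (hWM j) ((hTfin j).mono (hDT j))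
    have hcount : ∀ j, countSeries ℓ (T j) = countSeries ℓ (D j) + countSeries ℓ (T (j + 1)) :=
      fun j => by
        conv_lhs => rw [hTD j]
        exact countSeries_union ((hTfin j).mono (hDT j)) (hTfin _) (hdisj j)
    have hexD : ∀ j, ∀ x ∈ T j, ∃ i ≥ j, x ∈ D i := by
      rintro j x ⟨hx, hxW⟩
      have hx' := (hX x).1 hx
      obtain ⟨m, hm, hxm⟩ := Nat.find_spec hx'
      have hle : j ≤ Nat.find hx' := by
        by_contra! hlt
        exact hxW (.inr ⟨_, hlt, m, hm, hxm⟩)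
      refine ⟨_, hle, Set.mem_vadd_set.2 ⟨m, hm, ?_⟩, ?_⟩
      · rw [vadd_eq_add, add_assoc]
        exact hxm.symm
      · rintro (hy | ⟨i, hi, h⟩)
        · exact hxW (.inl hy)
        · exact Nat.find_min hx' hi h
    -- The positions in layer `j` that are already covered. Translation by `p` carries `W j` into `W
    -- (j + 1)`, so `Z` increases and becomes constant; from then on `T (j + 1)` is `T j` translated
    -- by `p`.
    let Z : ℕ → Set B := fun j => {m | m ∈ M ∧ f + (j • p + m) ∈ W j}
    have hshift : ∀ j x, x ∈ W j → x + p ∈ W (j + 1) := by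
      rintro j x (hy | ⟨i, hi, m, hm, rfl⟩)
      · exact .inl (hY _ hy _ hp)
      · exact .inr ⟨i + 1, Nat.succ_lt_succ hi, m, hm, by simp only [succ_nsmul]; abel⟩
    have hsucc : ∀ j m, f + ((j + 1) • p + m) = f + (j • p + m) + p := fun j m => by
      simp only [succ_nsmul]; abel
    obtain ⟨J, hJ⟩ := exists_forall_ge_eq_of_monotone (Z := Z) s
      (monotone_nat_of_le_succ fun j m hm => ⟨hm.1, by
        rw [hsucc]
        exact hshift _ _ hm.2⟩)
      (fun j m hm => hm.1)
      (fun j x hx m hm => ⟨add_mem hx.1 hm, by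
        simpa only [add_assoc] using hWM j _ hx.2 m hm⟩)
    have hstep : ∀ j, J ≤ j → T (j + 1) = (· + p) '' T j := by
      intro j hj
      ext x
      constructor
      · intro hx
        obtain ⟨i, hi, hxi, hxW⟩ := hexD _ x hx
        obtain ⟨m, hm, rfl⟩ := Set.mem_vadd_set.1 hxi
        obtain ⟨i, rfl⟩ : ∃ k, i = k + 1 := ⟨i - 1, by omega⟩
        rw [vadd_eq_add, add_assoc] at hxW ⊢
        have hm' : m ∉ Z i := by
          rw [hJ i (by omega), ← hJ (i + 1) (by omega)]
          exact fun h => hxW h.2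
        refine ⟨f + (i • p + m), ⟨(hX _).2 ⟨i, m, hm, rfl⟩, fun h => hm' ⟨hm, ?_⟩⟩, (hsucc i m).symm⟩
        exact hWmono (by omega) h
      · rintro ⟨x, hx, rfl⟩
        obtain ⟨i, hi, hxi, hxW⟩ := hexD _ x hx
        obtain ⟨m, hm, rfl⟩ := Set.mem_vadd_set.1 hxi
        rw [vadd_eq_add, add_assoc] at hxW ⊢
        have hm' : m ∉ Z (i + 1) := by
          rw [hJ (i + 1) (by omega), ← hJ i (by omega)]
          exact fun h => hxW h.2
        change f + (i • p + m) + p ∈ _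
        rw [← hsucc]
        exact ⟨(hX _).2 ⟨i + 1, m, hm, rfl⟩, fun h => hm' ⟨hm, hWmono (by omega) h⟩⟩
    have hcountJ : ∀ j, J ≤ j →
        countSeries ℓ (T j) = countSeries ℓ (D j) + PowerSeries.X ^ ℓ p * countSeries ℓ (T j) :=
      fun j hj => by
        rw [← countSeries_image_add_right, ← hstep j hj]
        exact hcount j
    have hTJ : IsRationalSeries (countSeries ℓ (T J)) := by
      rcases Nat.eq_zero_or_pos (ℓ p) with h0 | hpos
      -- If `ℓ p = 0` the recursion cannot be solved for `T`, but it forces `D j` to count zero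
      -- elements.
      · have hD : ∀ j, J ≤ j → D j = ∅ := fun j hj => by
          refine eq_empty_of_countSeries_eq_zero ((hTfin j).mono (hDT j)) ?_
          have := hcountJ j hj
          rwa [h0, pow_zero, one_mul, right_eq_add] at this
        have hTe : T J = ∅ := by
          refine Set.eq_empty_of_forall_notMem fun x hx => ?_
          obtain ⟨i, hi, hxi⟩ := hexD J x hx
          rw [hD i hi] at hxi
          exact hxi
        rw [hTe, countSeries_empty]
        exact .zero
      · exact .of_eq_add_X_pow_mul hpos (hDrat J) (hcountJ J le_rfl)
    have hTall : ∀ k, k ≤ J → IsRationalSeries (countSeries ℓ (T (J - k))) := by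
      intro k
      induction k with
      | zero => intro _; exact hTJ
      | succ k ihk =>
        intro hk
        rw [hcount]
        refine (hDrat _).add ?_
        have : J - (k + 1) + 1 = J - k := by omega
        rw [this]
        exact ihk (by omega)
    have := hTall J le_rfl
    rwa [Nat.sub_self, hT0] at this

/-! ### Counting semilinear sets -/

section FiniteTranslates

variable {B : Type*} [AddCancelCommMonoid B]

/-- A finite union of translates of one finitely generated submonoid. -/
def IsFiniteTranslates (X : Set B) : Prop :=
  ∃ (F : Set B) (P : AddSubmonoid B), F.Finite ∧ P.FG ∧ X = F + (P : Set B)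

theorem IsFiniteTranslates.isRationalSeries {X : Set B} (hX : IsFiniteTranslates X) (ℓ : B →+ ℕ)
    (hfin : FiniteFibers ℓ X) : IsRationalSeries (countSeries ℓ X) := by
  obtain ⟨F, P, hF, ⟨s, rfl⟩, rfl⟩ := hX
  induction F, hF using Set.Finite.induction_on with
  | empty =>
    rw [Set.empty_add, countSeries_empty]
    exact .zero
  | @insert f F _ _ ih =>
    have heq : insert f F + (closure (s : Set B) : Set B) =
        ((f +ᵥ (closure (s : Set B) : Set B)) \ (F + (closure (s : Set B) : Set B))) ∪
          (F + (closure (s : Set B) : Set B)) := by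
      rw [Set.insert_eq, Set.union_add, Set.singleton_add, Set.sdiff_union_self]
      rfl
    rw [heq] at hfin ⊢
    have h₁ := hfin.mono Set.subset_union_left
    have h₂ := hfin.mono Set.subset_union_right
    rw [countSeries_union h₁ h₂ Set.disjoint_sdiff_left]
    refine (isRationalSeries_countSeries_coset_diff ℓ s f _ ?_ h₁).add (ih h₂)
    rintro _ ⟨g, hg, m', hm', rfl⟩ m hm
    exact ⟨g, hg, m' + m, add_mem hm' hm, (add_assoc _ _ _).symm⟩

theorem IsFiniteTranslates.of_isLinearSet {X : Set B} (hX : IsLinearSet X) :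
    IsFiniteTranslates X := by
  obtain ⟨a, P, hP, rfl⟩ := isLinearSet_iff_exists_fg_eq_vadd.1 hX
  exact ⟨{a}, P, Set.finite_singleton a, hP, by rw [Set.singleton_add]; rfl⟩

/-- Common points come from solutions of `f + φ a = g + ψ b`. Dickson's lemma leaves finitely many
minimal ones, and by cancellation the difference from a minimal one solves `φ a = ψ b`. The period
monoid does not depend on `f` and `g`, so `IsFiniteTranslates` survives intersection. -/
theorem exists_finite_translates_inter {m n : ℕ} (φ : (Fin m → ℕ) →+ B) (ψ : (Fin n → ℕ) →+ B)
    (f g : B) : ∃ F : Set B, F.Finite ∧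
      {x | x ∈ f +ᵥ (AddMonoidHom.mrange φ : Set B) ∧ x ∈ g +ᵥ (AddMonoidHom.mrange ψ : Set B)} =
        F + ((AddMonoidHom.mrange φ ⊓ AddMonoidHom.mrange ψ : AddSubmonoid B) : Set B) := by
  let E : Set ((Fin m → ℕ) × (Fin n → ℕ)) := {z | f + φ z.1 = g + ψ z.2}
  have hpwo := Set.isPWO_of_wellQuasiOrderedLE E
  refine ⟨(fun z => f + φ z.1) '' {z | Minimal (· ∈ E) z},
    ((setOfPred_minimal_antichain _).finite_of_partiallyWellOrderedOn
      (hpwo.mono (setOfPred_minimal_subset _))).image _, ?_⟩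
  ext x
  constructor
  · rintro ⟨⟨_, ⟨a, rfl⟩, hx⟩, ⟨_, ⟨b, rfl⟩, hx'⟩⟩
    have hab : (a, b) ∈ E := hx.trans hx'.symm
    obtain ⟨z, hz, hmin⟩ : ∃ z ≤ (a, b), Minimal (· ∈ E) z :=
      exists_minimal_le_of_wellFoundedLT _ _ hab
    refine ⟨_, ⟨z, hmin, rfl⟩, φ (a - z.1), ⟨⟨_, rfl⟩, b - z.2, ?_⟩, ?_⟩
    · have h1 : φ a = φ z.1 + φ (a - z.1) := by
        rw [← map_add, add_tsub_cancel_of_le hz.1]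
      have h2 : ψ b = ψ z.2 + ψ (b - z.2) := by
        rw [← map_add, add_tsub_cancel_of_le hz.2]
      have h3 : f + φ a = g + ψ b := hab
      have h4 : f + φ z.1 = g + ψ z.2 := hmin.1
      rw [h1, h2, ← add_assoc, ← add_assoc, h4] at h3
      exact (add_left_cancel h3).symm
    · change f + φ z.1 + φ (a - z.1) = x
      rw [add_assoc, ← map_add, add_tsub_cancel_of_le hz.1]
      exact hx
  · rintro ⟨_, ⟨z, hz, rfl⟩, y, ⟨⟨a, ha⟩, ⟨b, hb⟩⟩, rfl⟩
    have h4 : f + φ z.1 = g + ψ z.2 := hz.1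
    refine ⟨⟨φ (z.1 + a), ⟨_, rfl⟩, ?_⟩, ⟨ψ (z.2 + b), ⟨_, rfl⟩, ?_⟩⟩
    · change f + φ (z.1 + a) = f + φ z.1 + y
      rw [map_add, ha, add_assoc]
    · change g + ψ (z.2 + b) = f + φ z.1 + y
      rw [map_add, hb, h4, add_assoc]

theorem fg_mrange_inf {m n : ℕ} (φ : (Fin m → ℕ) →+ B) (ψ : (Fin n → ℕ) →+ B) :
    (AddMonoidHom.mrange φ ⊓ AddMonoidHom.mrange ψ : AddSubmonoid B).FG := by
  have h := AddSubmonoid.fg_eqLocusM (M := (Fin m → ℕ) × (Fin n → ℕ)) (φ.comp (AddMonoidHom.fst (Fin m → ℕ) (Fin n → ℕ))) (ψ.comp (AddMonoidHom.snd (Fin m → ℕ) (Fin n → ℕ)))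
  convert! h.map (φ.comp (AddMonoidHom.fst (Fin m → ℕ) (Fin n → ℕ)))
  ext x
  constructor
  · rintro ⟨⟨a, ha⟩, ⟨b, hb⟩⟩
    exact ⟨(a, b), ha.trans hb.symm, ha⟩
  · rintro ⟨⟨a, b⟩, hab, rfl⟩
    exact ⟨⟨a, rfl⟩, ⟨b, hab.symm⟩⟩

theorem IsFiniteTranslates.inter {X Y : Set B} (hX : IsFiniteTranslates X)
    (hY : IsFiniteTranslates Y) : IsFiniteTranslates (X ∩ Y) := by
  obtain ⟨F, P, hF, hP, rfl⟩ := hX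
  obtain ⟨G, Q, hG, hQ, rfl⟩ := hY
  obtain ⟨m, φ, rfl⟩ := fg_iff_exists_fin_addMonoidHom.1 hP
  obtain ⟨n, ψ, rfl⟩ := fg_iff_exists_fin_addMonoidHom.1 hQ
  choose K hK hKeq using exists_finite_translates_inter φ ψ
  refine ⟨⋃ f ∈ F, ⋃ g ∈ G, K f g, _, hF.biUnion fun f _ => hG.biUnion fun g _ => hK f g,
    fg_mrange_inf φ ψ, ?_⟩
  ext x
  simp only [Set.iUnion_add, Set.mem_iUnion, ← hKeq, Set.mem_ofPred_eq, Set.mem_inter_iff]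
  constructor
  · rintro ⟨⟨f, hf, a, ha, hx⟩, ⟨g, hg, b, hb, hx'⟩⟩
    exact ⟨f, hf, g, hg, ⟨a, ha, hx⟩, ⟨b, hb, hx'⟩⟩
  · rintro ⟨f, hf, g, hg, ⟨a, ha, hx⟩, ⟨b, hb, hx'⟩⟩
    exact ⟨⟨f, hf, a, ha, hx⟩, ⟨g, hg, b, hb, hx'⟩⟩

/-- Inclusion-exclusion. The correction term is a union over the smaller index set `t` of the sets
`X a ∩ X i`, so the induction must range over all families `X`. -/
theorem isRationalSeries_countSeries_biUnion (ℓ : B →+ ℕ) {κ : Type*} (t : Finset κ) :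
    ∀ X : κ → Set B, (∀ i ∈ t, IsFiniteTranslates (X i)) → (∀ i ∈ t, FiniteFibers ℓ (X i)) →
      IsRationalSeries (countSeries ℓ (⋃ i ∈ t, X i)) := by
  classical
  induction t using Finset.induction_on with
  | empty =>
    intro X _ _
    simpa using IsRationalSeries.zero
  | insert a t _ ih =>
    intro X hX hfin
    simp only [Finset.mem_insert, forall_eq_or_imp] at hX hfin
    have hU : FiniteFibers ℓ (⋃ i ∈ t, X i) := by
      intro n
      refine (t.finite_toSet.biUnion fun i hi => hfin.2 i hi n).subset ?_
      rintro x ⟨hx, hxn⟩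
      obtain ⟨i, hi, hxi⟩ := Set.mem_iUnion₂.1 hx
      exact Set.mem_biUnion hi ⟨hxi, hxn⟩
    have h := countSeries_union_add_inter hfin.1 hU
    rw [Set.inter_iUnion₂] at h
    rw [Finset.set_biUnion_insert, eq_sub_of_add_eq h]
    refine ((hX.1.isRationalSeries ℓ hfin.1).add (ih X hX.2 hfin.2)).sub ?_
    exact ih _ (fun i hi => hX.1.inter (hX.2 i hi))
      fun i hi => hfin.1.mono Set.inter_subset_left

/-- A semilinear set with finite fibres has a rational counting series. -/
theorem _root_.IsSemilinearSet.isRationalSeries_countSeries {X : Set B} (hX : IsSemilinearSet X)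
    (ℓ : B →+ ℕ) (hfin : FiniteFibers ℓ X) : IsRationalSeries (countSeries ℓ X) := by
  obtain ⟨S, hS, rfl⟩ := isSemilinearSet_iff.1 hX
  rw [Set.sUnion_eq_biUnion] at hfin ⊢
  exact isRationalSeries_countSeries_biUnion ℓ S id
    (fun i hi => .of_isLinearSet (hS i hi))
    fun i hi => hfin.mono (Set.subset_biUnion_of_mem (u := fun s => s) hi)

end FiniteTranslates

/-! ### Labels of paths in a finite graph -/

section Paths

variable {Q B : Type*} [AddCommMonoid B]

/-- `PathLabel L T p q x` says that `x` is the sum of the labels of a nonempty path from `p` to `q`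
whose intermediate vertices lie in `T`, where `L p q` is the set of labels of edges `p → q`. -/
inductive PathLabel (L : Q → Q → Set B) (T : Set Q) (p : Q) : Q → B → Prop
  | single {q : Q} {x : B} (h : x ∈ L p q) : PathLabel L T p q x
  | snoc {m q : Q} {x y : B} (h : PathLabel L T p m x) (hm : m ∈ T) (hy : y ∈ L m q) :
      PathLabel L T p q (x + y)

variable {L : Q → Q → Set B} {T : Set Q} {p q r : Q} {x y : B}

theorem PathLabel.mono {T' : Set Q} (hT : T ⊆ T') (h : PathLabel L T p q x) :
    PathLabel L T' p q x := by
  induction h with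
  | single h => exact .single h
  | snoc _ hm hy ih => exact .snoc ih (hT hm) hy

theorem PathLabel.append (h : PathLabel L T p r x) (hr : r ∈ T) (h' : PathLabel L T r q y) :
    PathLabel L T p q (x + y) := by
  induction h' with
  | single h' => exact .snoc h hr h'
  | snoc _ hm hy ih =>
    rw [← add_assoc]
    exact .snoc ih hm hy

/-- Kleene's recursion: allowing one more intermediate vertex. -/
theorem setOf_pathLabel_insert :
    {x | PathLabel L (insert r T) p q x} = {x | PathLabel L T p q x} ∪
      ({x | PathLabel L T p r x} + (closure {x | PathLabel L T r r x} : Set B) +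
        {x | PathLabel L T r q x}) := by
  ext x
  constructor
  · intro h
    change PathLabel L (insert r T) p q x at h
    induction h with
    | single h => exact .inl (.single h)
    | @snoc m q x y _ hm hy ih =>
      rcases hm with rfl | hm
      -- The path stands at the new vertex before its last edge: either this is its first visit, or
      -- the segment since the previous visit is a loop absorbed into the closure.
      · refine .inr ?_
        rcases ih with ih | ⟨_, ⟨a, ha, b, hb, rfl⟩, c, hc, rfl⟩
        · exact ⟨_, ⟨x, ih, 0, zero_mem _, add_zero x⟩, y, .single hy, rfl⟩
        · exact ⟨_, ⟨a, ha, b + c, add_mem hb (subset_closure hc), rfl⟩, y, .single hy,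
            by simp only [add_assoc]⟩
      · rcases ih with ih | ⟨_, hab, c, hc, rfl⟩
        · exact .inl (.snoc ih hm hy)
        · exact .inr ⟨_, hab, c + y, .snoc hc hm hy, (add_assoc _ _ _).symm⟩
  · have hr : r ∈ insert r T := Set.mem_insert r T
    rintro (h | ⟨_, ⟨a, ha, b, hb, rfl⟩, c, hc, rfl⟩)
    · exact PathLabel.mono (Set.subset_insert r T) h
    · refine PathLabel.append ?_ hr (PathLabel.mono (Set.subset_insert r T) hc)
      have ha' := PathLabel.mono (Set.subset_insert r T) ha
      clear hc ha
      induction hb using closure_induction generalizing a with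
      | mem b hb => exact ha'.append hr (hb.mono (Set.subset_insert r T))
      | zero => simpa using ha'
      | add b b' _ _ ih ih' =>
        change PathLabel _ _ _ _ (a + (b + b'))
        rw [← add_assoc]
        exact ih' _ (ih _ ha')

theorem isSemilinearSet_pathLabel (hL : ∀ p q, IsSemilinearSet (L p q)) {T : Set Q}
    (hT : T.Finite) : ∀ p q, IsSemilinearSet {x | PathLabel L T p q x} := by
  induction T, hT using Set.Finite.induction_on with
  | empty =>
    intro p q
    convert! hL p q
    ext x
    constructor
    · rintro (h | ⟨_, h, _⟩)
      · exact h
      · exact h.elim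
    · exact .single
  | insert _ _ ih =>
    intro p q
    rw [setOf_pathLabel_insert]
    exact (ih p q).union (((ih p _).add (ih _ _).closure).add (ih _ q))

end Paths

/-! ### Coset coordinates, words and weights -/

section VirtuallyAbelian

variable {G : Type*} [Group G] {S : Finset G}

theorem weight_eq_iff (hS : Submonoid.closure (S : Set G) = ⊤) (ω : S → ℕ) {g : G} {n : ℕ} :
    weight ω g = n ↔ (∃ w : List S, wordValue w = g ∧ wordWeight ω w = n) ∧
      ∀ w : List S, wordValue w = g → n ≤ wordWeight ω w := by
  constructor
  · rintro rfl
    exact ⟨exists_word_weight hS ω g, fun w hw => Nat.sInf_le ⟨w, hw, rfl⟩⟩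
  · rintro ⟨⟨w, hw, rfl⟩, h⟩
    refine le_antisymm (Nat.sInf_le ⟨w, hw, rfl⟩) ?_
    obtain ⟨v, hv, hv'⟩ := exists_word_weight hS ω g
    exact hv' ▸ h v hv

variable (A : Subgroup G)

/-- The element of `G` with coordinate `a : A` in the coset `q`, based at the coset `p`. -/
noncomputable def cosetElement (p q : G ⧸ A) (a : A) : G := q.out * a * p.out⁻¹

theorem cosetElement_injective (p q : G ⧸ A) : Function.Injective (cosetElement A p q) := by
  intro a b h
  simpa [cosetElement] using h

theorem exists_cosetElement_eq (p : G ⧸ A) (g : G) : ∃ q a, cosetElement A p q a = g := by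
  have h : (QuotientGroup.mk (g * p.out) : G ⧸ A).out⁻¹ * (g * p.out) ∈ A := by
    rw [← QuotientGroup.eq, QuotientGroup.out_eq']
  refine ⟨QuotientGroup.mk (g * p.out), ⟨_, h⟩, ?_⟩
  simp [cosetElement]

theorem eq_of_cosetElement_eq {p q q' : G ⧸ A} {a b : A}
    (h : cosetElement A p q a = cosetElement A p q' b) : q = q' := by
  have h' : q.out * a = q'.out * b := by simpa [cosetElement] using h
  rw [← QuotientGroup.out_eq' q, ← QuotientGroup.out_eq' q', QuotientGroup.eq]
  have : q.out⁻¹ * q'.out = a * (b : G)⁻¹ := by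
    rw [eq_mul_inv_iff_mul_eq, mul_assoc, ← h', inv_mul_cancel_left]
  rw [this]
  exact A.mul_mem a.2 (A.inv_mem b.2)

theorem cosetElement_self_eq_one_iff {p : G ⧸ A} {a : A} : cosetElement A p p a = 1 ↔ a = 1 := by
  simp [cosetElement]

/-- Representatives of the middle coset cancel, so coordinates multiply along a path; commutativity
of `A` makes the order irrelevant. -/
theorem cosetElement_mul [IsMulCommutative A] (p m q : G ⧸ A) (a b : A) :
    cosetElement A m q b * cosetElement A p m a = cosetElement A p q (a * b) := by
  rw [mul_comm' a b]
  simp [cosetElement, mul_assoc]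

/-- Coordinates and weights of the words leading from the coset `p` to the coset `q`. -/
def wordLabels (ω : S → ℕ) (p q : G ⧸ A) : Set (Additive A × ℕ) :=
  {x | ∃ w : List S, wordValue w = cosetElement A p q x.1.toMul ∧ wordWeight ω w = x.2}

/-- Coordinates and weights of the letters leading from the coset `p` to the coset `q`. -/
def letterLabels (ω : S → ℕ) (p q : G ⧸ A) : Set (Additive A × ℕ) :=
  {x | ∃ s : S, (s : G) = cosetElement A p q x.1.toMul ∧ ω s = x.2}

theorem finite_letterLabels (ω : S → ℕ) (p q : G ⧸ A) : (letterLabels A ω p q).Finite := by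
  choose f hf using fun x : letterLabels A ω p q => x.2
  refine Set.finite_coe_iff.1 (Finite.of_injective f fun x y hxy => Subtype.ext ?_)
  refine Prod.ext ?_ ?_
  · refine Additive.toMul.injective (cosetElement_injective A p q ?_)
    rw [← (hf x).1, ← (hf y).1, hxy]
  · rw [← (hf x).2, ← (hf y).2, hxy]

variable [IsMulCommutative A]

/-- Words act on cosets from the left, so the first letter of a word is the last edge of its path.
Paths are nonempty, hence the separate term for the empty word. -/
theorem wordLabels_eq (ω : S → ℕ) (p q : G ⧸ A) :
    wordLabels A ω p q = {x | PathLabel (letterLabels A ω) Set.univ p q x} ∪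
      {x | x = 0 ∧ p = q} := by
  ext x
  constructor
  · rintro ⟨w, hw, hx⟩
    induction w generalizing q x with
    | nil =>
      obtain rfl : p = q := by
        refine eq_of_cosetElement_eq A (p := p) (a := 1) (b := x.1.toMul) ?_
        rw [← hw, (cosetElement_self_eq_one_iff A).2 rfl]
        rfl
      refine .inr ⟨Prod.ext ?_ hx.symm, rfl⟩
      exact (cosetElement_self_eq_one_iff A).1 hw.symm
    | cons s w ih =>
      obtain ⟨m, a, ha⟩ := exists_cosetElement_eq A p (wordValue w)
      have hs : (s : G) = cosetElement A m q (x.1.toMul * a⁻¹) := by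
        have h1 : (s : G) * wordValue w = cosetElement A p q x.1.toMul := by
          rw [← hw]
          simp [wordValue]
        rw [← ha] at h1
        refine mul_right_cancel (b := cosetElement A p m a) ?_
        rw [h1, cosetElement_mul, mul_comm' _ a⁻¹, mul_inv_cancel_left]
      have hx' : ω s + wordWeight ω w = x.2 := by
        rw [← hx]
        simp [wordWeight]
      have hxe : x = (Additive.ofMul a, wordWeight ω w) + (x.1 - Additive.ofMul a, ω s) :=
        Prod.ext (by simp) (by simp [← hx', add_comm])
      have hsl : (x.1 - Additive.ofMul a, ω s) ∈ letterLabels A ω m q :=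
        ⟨s, by simpa [div_eq_mul_inv] using hs, rfl⟩
      rw [hxe]
      rcases ih m (Additive.ofMul a, wordWeight ω w) ha.symm rfl with h | ⟨h0, rfl⟩
      · exact .inl (.snoc h trivial hsl)
      · rw [h0, zero_add]
        exact .inl (.single hsl)
  · rintro (h | ⟨rfl, rfl⟩)
    · change PathLabel _ _ _ _ _ at h
      induction h with
      | single h =>
        obtain ⟨s, hs, hx⟩ := h
        exact ⟨[s], by simpa [wordValue] using hs, by simpa [wordWeight] using hx⟩
      | snoc _ _ hy ih =>
        obtain ⟨w, hw, hx⟩ := ih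
        obtain ⟨s, hs, hy⟩ := hy
        refine ⟨s :: w, ?_, ?_⟩
        · rw [Prod.fst_add, toMul_add, ← cosetElement_mul, ← hw, ← hs]
          simp [wordValue]
        · rw [Prod.snd_add, ← hx, ← hy]
          simp [wordWeight, add_comm]
    · exact ⟨[], ((cosetElement_self_eq_one_iff A).2 rfl).symm, rfl⟩

theorem isSemilinearSet_wordLabels [A.FiniteIndex] (ω : S → ℕ) (p q : G ⧸ A) :
    IsSemilinearSet (wordLabels A ω p q) := by
  rw [wordLabels_eq]
  refine (isSemilinearSet_pathLabel (fun p q => .of_finite (finite_letterLabels A ω p q))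
    Set.finite_univ p q).union (.of_finite ((Set.finite_singleton 0).subset ?_))
  exact fun x hx => hx.1

/-- The graph of the weight function on the coset `q`. -/
def weightGraph (ω : S → ℕ) (p q : G ⧸ A) : Set (Additive A × ℕ) :=
  {x | weight ω (cosetElement A p q x.1.toMul) = x.2}

/-- A label has minimal weight exactly when it is not another label raised by a positive amount in
the second coordinate; semilinear sets are closed under sums and differences. -/
theorem isSemilinearSet_weightGraph [A.FiniteIndex] (hS : Submonoid.closure (S : Set G) = ⊤)
    (ω : S → ℕ) (p q : G ⧸ A) : IsSemilinearSet (weightGraph A ω p q) := by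
  have h := isSemilinearSet_wordLabels A ω p q
  have hup : IsSemilinearSet
      (((0, 1) : Additive A × ℕ) +ᵥ (closure ({(0, 1)} : Set (Additive A × ℕ)) : Set (Additive A × ℕ))) :=
    (IsSemilinearSet.closure_of_finite (Set.finite_singleton _)).vadd _
  convert! h.sdiff (h.add hup)
  ext ⟨a, n⟩
  change weight ω _ = n ↔ _
  rw [weight_eq_iff hS]
  refine and_congr Iff.rfl ⟨?_, ?_⟩
  · rintro hle ⟨⟨b, k⟩, ⟨w, hw, rfl⟩, _, ⟨y, hy, rfl⟩, hab⟩
    obtain ⟨i, rfl⟩ := mem_closure_singleton.1 hy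
    simp only [vadd_eq_add, Prod.smul_mk, smul_zero, smul_eq_mul, mul_one, Prod.mk_add_mk,
      add_zero, Prod.mk.injEq] at hab
    obtain ⟨rfl, rfl⟩ := hab
    have := hle w hw
    omega
  · intro hn w hw
    by_contra! hlt
    refine hn ⟨(a, wordWeight ω w), ⟨w, hw, rfl⟩, _,
      ⟨_, mem_closure_singleton.2 ⟨n - wordWeight ω w - 1, rfl⟩, rfl⟩, ?_⟩
    simp only [vadd_eq_add, Prod.smul_mk, smul_zero, smul_eq_mul, mul_one, Prod.mk_add_mk,
      add_zero, Prod.mk.injEq, true_and]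
    omega

/-- If nonempty, the set of coordinates is a translate of `K`, the preimage of `H` under conjugation
by `p.out`. `K` is finitely generated because `Additive A` is a Noetherian `ℤ`-module. -/
theorem isSemilinearSet_subgroup_coords [Group.FG A] (p q : G ⧸ A) (H : Subgroup G) :
    IsSemilinearSet {x : Additive A × ℕ | cosetElement A p q x.1.toMul ∈ H} := by
  rcases Set.eq_empty_or_nonempty {a : Additive A | cosetElement A p q a.toMul ∈ H} with he | ⟨a, ha⟩
  · have : {x : Additive A × ℕ | cosetElement A p q x.1.toMul ∈ H} = ∅ :=
      Set.eq_empty_of_forall_notMem fun x hx =>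
        (he ▸ (show x.1 ∈ {a : Additive A | cosetElement A p q a.toMul ∈ H} from hx) :
          x.1 ∈ (∅ : Set (Additive A)))
    rw [this]
    exact .empty
  · let K : AddSubgroup (Additive A) :=
      (H.comap ((MulAut.conj p.out).toMonoidHom.comp A.subtype)).toAddSubgroup
    have hmem : ∀ b : Additive A, b ∈ K ↔ p.out * (b.toMul : G) * p.out⁻¹ ∈ H := fun b => Iff.rfl
    have : AddGroup.FG (Additive A) := inferInstance
    have : Module.Finite ℤ (Additive A) := Module.Finite.iff_addGroup_fg.2 this
    have hK : K.toAddSubmonoid.FG := by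
      rw [← AddSubgroup.fg_iff_addSubmonoid_fg]
      have := IsNoetherian.noetherian (AddSubgroup.toIntSubmodule K)
      rw [Submodule.fg_iff_addSubgroup_fg] at this
      simpa using this
    have : AddMonoid.FG (Additive A × ℕ) := inferInstance
    have h := ((IsSemilinearSet.of_fg hK).vadd a).preimage (AddMonoidHom.fst (Additive A) ℕ)
    convert! h
    ext ⟨b, n⟩
    have hb : cosetElement A p q b.toMul =
        cosetElement A p q a.toMul * (p.out * ((b - a).toMul : G) * p.out⁻¹) := by
      have hba : (b.toMul : G) = a.toMul * (b - a).toMul := by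
        rw [← Subgroup.coe_mul, ← toMul_add, add_sub_cancel]
      simp only [cosetElement, hba, mul_assoc, inv_mul_cancel_left]
    change cosetElement A p q b.toMul ∈ H ↔ b ∈ a +ᵥ (K : Set (Additive A))
    rw [hb, H.mul_mem_cancel_left ha, ← hmem, Set.mem_vadd_set_iff_neg_vadd_mem, vadd_eq_add,
      neg_add_eq_sub]
    rfl

end VirtuallyAbelian

/-! ### Summation over the cosets -/

theorem isRationalSeries_relGrowthSeries {G : Type*} [Group G] (A : Subgroup G)
    [IsMulCommutative A] [A.FiniteIndex] {S : Finset G}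
    (hS : Submonoid.closure (S : Set G) = ⊤) {ω : S → ℕ} (hω : ∀ s, 0 < ω s)
    {ι : Type*} [Finite ι] (H : ι → Subgroup G) :
    IsRationalSeries (relGrowthSeries ω (⋃ i, (H i : Set G))) := by
  classical
  have : Group.FG G := by
    refine ⟨⟨S, ?_⟩⟩
    rw [← top_le_iff, ← Subgroup.toSubmonoid_le, Subgroup.top_toSubmonoid, ← hS]
    exact Submonoid.closure_le.2 Subgroup.subset_closure
  have : Group.FG A := A.fg_of_index_ne_zero
  have : Fintype (G ⧸ A) := Fintype.ofFinite _
  set U : Set G := ⋃ i, (H i : Set G) with hU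
  -- Any base coset would do: every element has unique coordinates relative to it.
  let p : G ⧸ A := QuotientGroup.mk 1
  let X : G ⧸ A → Set (Additive A × ℕ) := fun q =>
    weightGraph A ω p q ∩ {x | cosetElement A p q x.1.toMul ∈ U}
  let e : ∀ q, Additive A × ℕ → G := fun q x => cosetElement A p q x.1.toMul
  have hX : ∀ q, IsSemilinearSet (X q) := fun q => by
    refine (isSemilinearSet_weightGraph A hS ω p q).inter ?_
    have : {x : Additive A × ℕ | cosetElement A p q x.1.toMul ∈ U} =
        ⋃ i, {x : Additive A × ℕ | cosetElement A p q x.1.toMul ∈ H i} := by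
      ext x
      simp [hU]
    rw [this]
    exact .iUnion fun i => isSemilinearSet_subgroup_coords A p q (H i)
  have hinj : ∀ q n, Set.InjOn (e q) {x | x ∈ X q ∧ x.2 = n} := by
    rintro q n ⟨a, k⟩ ⟨-, rfl⟩ ⟨b, l⟩ ⟨-, rfl⟩ hab
    exact Prod.ext (Additive.toMul.injective (cosetElement_injective A p q hab)) rfl
  have himage : ∀ n, {g | g ∈ U ∧ weight ω g = n} =
      ⋃ q, e q '' {x | x ∈ X q ∧ x.2 = n} := by
    intro n
    ext g
    simp only [Set.mem_iUnion]
    constructor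
    · rintro ⟨hg, hn⟩
      obtain ⟨q, a, rfl⟩ := exists_cosetElement_eq A p g
      exact ⟨q, (Additive.ofMul a, n), ⟨⟨hn, hg⟩, rfl⟩, rfl⟩
    · rintro ⟨q, x, ⟨⟨hn, hg⟩, rfl⟩, rfl⟩
      exact ⟨hg, hn⟩
  have hfin : ∀ q, FiniteFibers (AddMonoidHom.snd (Additive A) ℕ) (X q) := fun q n => by
    refine Set.Finite.of_finite_image ((finite_weight_eq hS ω hω U n).subset ?_) (hinj q n)
    rw [himage]
    exact fun g hg => Set.mem_iUnion.2 ⟨q, hg⟩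
  have hsum : relGrowthSeries ω U =
      ∑ q, countSeries (AddMonoidHom.snd (Additive A) ℕ) (X q) := by
    ext n
    rw [map_sum]
    simp only [relGrowthSeries, relGrowth, countSeries, PowerSeries.coeff_mk, himage]
    rw [Set.ncard_iUnion_of_finite (s := fun q => e q '' {x | x ∈ X q ∧ x.2 = n})
      (fun q => (hfin q n).image (e q)), finsum_eq_sum_of_fintype,
      Nat.cast_sum]
    · exact Finset.sum_congr rfl fun q _ => congrArg _ (hinj q n).ncard_image
    · intro q q' hne
      refine Set.disjoint_left.2 ?_
      rintro _ ⟨x, -, rfl⟩ ⟨y, -, hxy⟩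
      exact hne (eq_of_cosetElement_eq A hxy.symm)
  rw [hsum]
  exact .sum _ fun q _ => (hX q).isRationalSeries_countSeries _ (hfin q)

end WeightedGrowth

theorem corollary3p4 {G : Type*} [Group G] (hG : WeightedGrowth.IsVirtuallyAbelian G)
    (S : Finset G) (hS : Submonoid.closure (S : Set G) = ⊤)
    (ω : S → ℕ) (hω : ∀ s, 0 < ω s)
    {ι : Type*} [Finite ι] (H : ι → Subgroup G) :
    WeightedGrowth.IsRationalSeries
      (WeightedGrowth.relGrowthSeries ω (⋃ i, (H i : Set G))) := by
  obtain ⟨A, hA, hA'⟩ := hG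
  exact WeightedGrowth.isRationalSeries_relGrowthSeries A hS hω H
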